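/- **Setting.** Let $SO(3)=\{R\in\mathbb{R}^{3\times 3}: R^TR=I,\ \det R=1\}$ carry the Riemannian metric $V\cdot W=\tfrac12\operatorname{tr}(V^TW)$ on the tangent spaces $T_RSO(3)=\{RA: A^T=-A\}$; its geodesic distance is $d(R,Q)=\arccos\big(\tfrac12(\operatorname{tr}(R^TQ)-1)\big)$, and $\nabla$ denotes its Riemannian gradient. Fix $\varepsilon\in(0,\pi/2)$ and let $\mathcal D_\varepsilon=\{R\in SO(3): d(I,R)<\tfrac{\pi}{2}-\varepsilon\}$. Let $\mathcal P(\mathcal D_\varepsilon)$ be the set of Borel probability measures on $\mathcal D_\varepsilon$, and for $\mu,\nu\in\mathcal P(\mathcal D_\varepsilon)$ let $$W_1(\mu,\nu)=\inf_{\pi\in\Pi(\mu,\nu)}\int_{\mathcal D_\varepsilon\times\mathcal D_\varepsilon} d(R,Q)\,\mathrm d\pi(R,Q),$$ where $\Pi(\mu,\nu)$ is the set of measures on $\mathcal D_\varepsilon\times\mathcal D_\varepsilon$ with marginals $\mu$ and $\nu$. Let $K:SO(3)\times SO(3)\to\mathbb R$ be of the form $K(R,Q)=g(d(R,Q)^2)$,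 where $g:[0,\infty)\to\mathbb R$ is differentiable with locally Lipschitz continuous derivative, and write $K_Q(R)=K(R,Q)$. For a curve $(\rho_t)_{t\in[0,T)}$ in $\mathcal P(\mathcal D_\varepsilon)$, with $T\in(0,\infty]$, let $$v[\rho](R,t)=-\int_{\mathcal D_\varepsilon}\nabla K_Q(R)\,\mathrm d\rho_t(Q),\qquad (R,t)\in\mathcal D_\varepsilon\times[0,T).$$ The curve is a *weak solution* on $[0,T)$ of $\partial_t\rho+\nabla\cdot(\rho v)=0$, $v=-\nabla K*\rho$, starting from $\rho_0$, if there is a unique flow map $\Psi:\operatorname{supp}(\rho_0)\times[0,T)\to\mathcal D_\varepsilon$ with $\frac{\mathrm d}{\mathrm dt}\Psi^t(R)=v[\rho](\Psi^t(R),t)$ and $\Psi^0(R)=R$ for all $R\in\operatorname{supp}(\rho_0)$ and $t\in[0,T)$, and $\rho_t=\Psi^t\#\rho_0$ (push-forward) for all $t\in[0,T)$. **Theorem (Mean-field limit).** Let $\rho_0\in\mathcal P(\mathcal D_\varepsilon)$, and for every integer $N\ge 1$ let $\rho_0^N=\sum_{i=1}^N m_i^N\,\delta_{R_i^N}$ with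 $R_i^N\in\mathcal D_\varepsilon$, $m_i^N>0$ and $\sum_{i=1}^N m_i^N=1$. Suppose that $$W_1(\rho_0^N,\rho_0)\to 0\qquad\text{as } N\to\infty.$$ Let $T\in(0,\infty]$, and suppose that $\rho$ and $\rho^N$ ($N\ge1$) are weak solutions on $[0,T)$ starting from $\rho_0$ and $\rho_0^N$, respectively. Then there exists $T^*\in(0,T)$ such that $$\sup_{t\in[0,T^*)}W_1(\rho^N_t,\rho_t)\to 0\qquad\text{as } N\to\infty.$$ -/

import Mathlib

open MeasureTheory Set Filter
open scoped Topology ENNReal Matrix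

namespace RotationAggregation

/-- The rotation group `SO(3)`, with the topology it has as a subset of `ℝ^{3 × 3}`. -/
abbrev SO3 : Type := ↥(Matrix.specialOrthogonalGroup (Fin 3) ℝ)

/-- Borel sets of `SO(3)`. -/
instance instMeasurableSpaceSO3 : MeasurableSpace SO3 := borel SO3

instance instBorelSpaceSO3 : BorelSpace SO3 := ⟨rfl⟩

/-- A rotation as a matrix. -/
abbrev mat (R : SO3) : Matrix (Fin 3) (Fin 3) ℝ := R.1

/-- The Riemannian metric `(1/2) ⟨V, W⟩_F = (1/2) tr (Vᵀ W)` (it is evaluated at tangent vectors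
of `SO(3)` with the same foot point, which are regarded as matrices). -/
noncomputable def metric (V W : Matrix (Fin 3) (Fin 3) ℝ) : ℝ :=
  (1 / 2) * (Vᵀ * W).trace

/-- The tangent space `T_R SO(3) = {R A : A skew symmetric}`. -/
def tangent (R : SO3) : Set (Matrix (Fin 3) (Fin 3) ℝ) :=
  {V | ∃ A : Matrix (Fin 3) (Fin 3) ℝ, Aᵀ = -A ∧ V = mat R * A}

/-- The geodesic distance on `SO(3)` of the metric above, that is, the rotation angle of `Rᵀ Q`. -/
noncomputable def dist (R Q : SO3) : ℝ :=
  Real.arccos ((((mat R)ᵀ * mat Q).trace - 1) / 2)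

/-- `γ` has derivative `V` at `t` within the set of times `s`; entrywise, in the ambient space
`ℝ^{3 × 3}`. -/
def HasVelocityWithinAt (γ : ℝ → SO3) (V : Matrix (Fin 3) (Fin 3) ℝ) (s : Set ℝ) (t : ℝ) : Prop :=
  ∀ i j, HasDerivWithinAt (fun u => mat (γ u) i j) (V i j) s t

/-- `V` is the Riemannian gradient of `φ` at `R`: it is tangent at `R`, and `φ` has derivative
`g(V, γ'(0))` along every curve `γ` in `SO(3)` through `R` that is differentiable at time `0`. -/
def IsGradientAt (φ : SO3 → ℝ) (R : SO3) (V : Matrix (Fin 3) (Fin 3) ℝ) : Prop :=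
  V ∈ tangent R ∧
    ∀ (γ : ℝ → SO3) (W : Matrix (Fin 3) (Fin 3) ℝ), γ 0 = R →
      HasVelocityWithinAt γ W univ 0 → HasDerivAt (fun u => φ (γ u)) (metric V W) 0

open Classical in
/-- The Riemannian gradient `∇φ(R)`; it is `0` by convention where `φ` has no gradient. -/
noncomputable def gradient (φ : SO3 → ℝ) (R : SO3) : Matrix (Fin 3) (Fin 3) ℝ :=
  if h : ∃ V, IsGradientAt φ R V then h.choose else 0

/-- Hypothesis on the interaction potential: `K(R, Q) = g(d(R, Q)²)` where `g : [0, ∞) → ℝ` is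
differentiable with locally Lipschitz continuous derivative (`g'` below; the values of `g` and
`g'` on the negative half-line play no role). -/
def IsInteractionPotential (K : SO3 → SO3 → ℝ) : Prop :=
  ∃ g g' : ℝ → ℝ,
    (∀ x ∈ Ici (0 : ℝ), HasDerivWithinAt g (g' x) (Ici 0) x) ∧
    LocallyLipschitzOn (Ici 0) g' ∧
    ∀ R Q, K R Q = g (dist R Q ^ 2)

/-- The open geodesic disk of radius `π / 2 - ε` centred at the identity. -/
abbrev Disk (ε : ℝ) : Type := {R : SO3 // dist 1 R < Real.pi / 2 - ε}

/-- The velocity `-∇K * μ (R) = -∫ ∇K_Q(R) dμ(Q)` at `R`, where `K_Q(R) = K(R, Q)`. -/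
noncomputable def velocity {ε : ℝ} (K : SO3 → SO3 → ℝ) (μ : ProbabilityMeasure (Disk ε))
    (R : Disk ε) : Matrix (Fin 3) (Fin 3) ℝ :=
  Matrix.of fun i j =>
    -∫ Q : Disk ε, gradient (fun R' => K R' Q.1) R.1 i j ∂(μ : Measure (Disk ε))

/-- The time interval `[0, T)`, where `T = ∞` is allowed. -/
def timeInterval (T : EReal) : Set ℝ := {t | 0 ≤ t ∧ (t : EReal) < T}

/-- `Ψ` is a flow map on `S × [0, T)`, with values in the disk, generated by the time-dependent
vector field `X` on the disk. -/
def IsFlowMap {ε : ℝ} (X : ℝ → Disk ε → Matrix (Fin 3) (Fin 3) ℝ) (S : Set (Disk ε)) (T : EReal)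
    (Ψ : ℝ → Disk ε → Disk ε) : Prop :=
  ∀ R ∈ S, Ψ 0 R = R ∧ ∀ t ∈ timeInterval T,
    HasVelocityWithinAt (fun u => (Ψ u R).1) (X t (Ψ t R)) (timeInterval T) t

/-- `(ρ t)_{t ∈ [0, T)}` is a weak solution in the disk of `∂ₜρ + ∇ ⬝ (ρ v) = 0`, `v = -∇K * ρ`:
the velocity field `v[ρ]` generates a unique flow map on `supp (ρ 0) × [0, T)`, and `ρ t` is the
push-forward of `ρ 0` under it. (The values of `ρ` outside `[0, T)`, and those of `Ψ` outside
`[0, T) × supp (ρ 0)`, play no role. Since `ρ t` is a probability measure, the last equation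
forces `Ψ t` to be almost everywhere measurable.) -/
def IsWeakSolution {ε : ℝ} (K : SO3 → SO3 → ℝ) (T : EReal)
    (ρ : ℝ → ProbabilityMeasure (Disk ε)) : Prop :=
  ∃ Ψ : ℝ → Disk ε → Disk ε,
    IsFlowMap (fun t => velocity K (ρ t)) (ρ 0 : Measure (Disk ε)).support T Ψ ∧
    (∀ Ψ' : ℝ → Disk ε → Disk ε,
      IsFlowMap (fun t => velocity K (ρ t)) (ρ 0 : Measure (Disk ε)).support T Ψ' →
      ∀ R ∈ (ρ 0 : Measure (Disk ε)).support, ∀ t ∈ timeInterval T, Ψ' t R = Ψ t R) ∧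
    ∀ t ∈ timeInterval T,
      (ρ t : Measure (Disk ε)) = Measure.map (Ψ t) (ρ 0 : Measure (Disk ε))

/-- `μ = ∑ mᵢ δ_{Rᵢ}` is an empirical measure of `N` particles with positive masses `mᵢ` of total
mass `1` and positions `Rᵢ` in the disk. -/
def IsEmpirical {ε : ℝ} (N : ℕ) (μ : ProbabilityMeasure (Disk ε)) : Prop :=
  ∃ (m : Fin N → ℝ) (R : Fin N → Disk ε), (∀ i, 0 < m i) ∧ ∑ i, m i = 1 ∧
    (μ : Measure (Disk ε)) = ∑ i, ENNReal.ofReal (m i) • Measure.dirac (R i)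

/-- The intrinsic `1`-Wasserstein distance: the infimum of `∫ d(R, Q) dπ(R, Q)` over the transport
plans `π` between `μ` and `ν`. -/
noncomputable def W1 {ε : ℝ} (μ ν : ProbabilityMeasure (Disk ε)) : ℝ≥0∞ :=
  ⨅ π ∈ {π : Measure (Disk ε × Disk ε) |
      π.map Prod.fst = (μ : Measure (Disk ε)) ∧ π.map Prod.snd = (ν : Measure (Disk ε))},
    ∫⁻ p, ENNReal.ofReal (dist p.1.1 p.2.1) ∂π

end RotationAggregation

namespace RotationAggregation

/-! The argument is a Dobrushin-type coupling estimate. Two rotations in the disk differ by an angle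
of at most `π - 2ε` (`disk_cosAngle_ge`), so they stay away from the cut locus. There `d` is
equivalent to the entrywise chordal distance, and `∇K_Q(R)` has the closed form `gradientField`,
which is bounded and Lipschitz in both variables (`boundedLipschitz_gradient`). Consequently the
velocity is Lipschitz in the position and, through the cost of any transport plan, in the measure
(`exists_velocity_lipschitz`).

Take any plan between two initial measures, push it forward by the two flows, and let `M` be the
supremum of its chordal cost over `[0, τ]`. For small `τ`, Grönwall along pairs of trajectories
gives `M ≤ (3/2) · (initial cost) + M/2`, so `M` is at most three times the initial cost. The
infimum over plans yields `exists_W1_stability`. Its time span and its constant do not depend on the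
two solutions, which gives the limit. -/

/-! ### Rotation matrices and the chordal distance -/

theorem transpose_mul_mat (R : SO3) : (mat R)ᵀ * mat R = 1 :=
  (Matrix.mem_orthogonalGroup_iff' _ _).1 (Matrix.mem_specialOrthogonalGroup_iff.1 R.2).1

theorem mat_mul_transpose (R : SO3) : mat R * (mat R)ᵀ = 1 :=
  (Matrix.mem_orthogonalGroup_iff _ _).1 (Matrix.mem_specialOrthogonalGroup_iff.1 R.2).1

theorem det_mat (R : SO3) : (mat R).det = 1 := (Matrix.mem_specialOrthogonalGroup_iff.1 R.2).2

/-- The cosine of the rotation angle of `Rᵀ Q`. -/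
noncomputable def cosAngle (R Q : SO3) : ℝ := (((mat R)ᵀ * mat Q).trace - 1) / 2

theorem dist_eq (R Q : SO3) : dist R Q = Real.arccos (cosAngle R Q) := rfl

theorem adjugate_eq_transpose {M : Matrix (Fin 3) (Fin 3) ℝ} (h : M * Mᵀ = 1) (hd : M.det = 1) :
    M.adjugate = Mᵀ := by
  have h1 : M.adjugate * M = 1 := by rw [Matrix.adjugate_mul, hd, one_smul]
  calc M.adjugate = M.adjugate * (M * Mᵀ) := by rw [h, mul_one]
    _ = Mᵀ := by rw [← mul_assoc, h1, one_mul]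

/-- Cayley–Hamilton for the adjugate of a `3 × 3` matrix. -/
theorem adjugate_eq_sq_sub (M : Matrix (Fin 3) (Fin 3) ℝ) :
    M.adjugate = M * M - M.trace • M + M.adjugate.trace • (1 : Matrix (Fin 3) (Fin 3) ℝ) := by
  ext i j
  fin_cases i <;> fin_cases j <;>
    simp [Matrix.adjugate_fin_three, Matrix.trace_fin_three, Matrix.mul_apply,
      Fin.sum_univ_three] <;> ring

/-- The symmetric part `S` of a rotation `M` satisfies `(S - 1) (S - c) = 0`, where `c` is the
cosine of the rotation angle. -/
theorem symmetric_part_quadratic {M : Matrix (Fin 3) (Fin 3) ℝ} (h : M * Mᵀ = 1)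
    (hd : M.det = 1) :
    (M + Mᵀ - 2) * (M + Mᵀ - (M.trace - 1) • (1 : Matrix (Fin 3) (Fin 3) ℝ)) = 0 := by
  have h' : Mᵀ * M = 1 := mul_eq_one_comm.1 h
  -- The adjugate of a rotation is its transpose, so this identity makes `M * M` a linear
  -- combination of `M`, `Mᵀ` and `1`.
  have e := adjugate_eq_sq_sub M
  rw [adjugate_eq_transpose h hd, Matrix.trace_transpose] at e
  have e1 : M * M = Mᵀ + M.trace • M - M.trace • (1 : Matrix (Fin 3) (Fin 3) ℝ) := by
    calc M * M = (M * M - M.trace • M + M.trace • (1 : Matrix (Fin 3) (Fin 3) ℝ)) + M.trace • M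
          - M.trace • (1 : Matrix (Fin 3) (Fin 3) ℝ) := by abel
      _ = _ := by rw [← e]
  have e2 : Mᵀ * Mᵀ = M + M.trace • Mᵀ - M.trace • (1 : Matrix (Fin 3) (Fin 3) ℝ) := by
    have := congrArg Matrix.transpose e1
    simpa [Matrix.transpose_mul] using this
  have : (2 : Matrix (Fin 3) (Fin 3) ℝ) = (2 : ℝ) • 1 := by
    rw [two_smul, one_add_one_eq_two]
  rw [this]
  simp only [sub_mul, mul_sub, add_mul, mul_add, mul_one, one_mul, h, h', e1, e2,
    Matrix.mul_smul, Matrix.smul_mul]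
  module

/-- The chordal distance: the maximal distance of entries. -/
noncomputable def chord (R Q : SO3) : ℝ :=
  ‖(fun i j => mat R i j - mat Q i j : Fin 3 → Fin 3 → ℝ)‖

theorem chord_nonneg (R Q : SO3) : 0 ≤ chord R Q := norm_nonneg _

theorem abs_entry_sub_le_chord (R Q : SO3) (i j : Fin 3) :
    |mat R i j - mat Q i j| ≤ chord R Q :=
  (norm_le_pi_norm (fun j => mat R i j - mat Q i j) j).trans
    (norm_le_pi_norm (fun i j => mat R i j - mat Q i j : Fin 3 → Fin 3 → ℝ) i)

theorem continuous_entry (i j : Fin 3) : Continuous fun R : SO3 => mat R i j :=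
  continuous_subtype_val.matrix_elem i j

theorem continuous_chord {X : Type*} [TopologicalSpace X] {f g : X → SO3} (hf : Continuous f)
    (hg : Continuous g) : Continuous fun x => chord (f x) (g x) :=
  continuous_norm.comp (continuous_pi fun i => continuous_pi fun j =>
    ((continuous_entry i j).comp hf).sub ((continuous_entry i j).comp hg))

/-- Each rotation has squared Frobenius norm 3, and the cross term is the trace defining `cosAngle`.
-/
theorem sum_sq_entry_sub (R Q : SO3) :
    ∑ i, ∑ j, (mat R i j - mat Q i j) ^ 2 = 4 * (1 - cosAngle R Q) := by
  have hR := congrArg Matrix.trace (transpose_mul_mat R)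
  have hQ := congrArg Matrix.trace (transpose_mul_mat Q)
  simp only [cosAngle, Matrix.trace_fin_three, Matrix.mul_apply, Matrix.transpose_apply,
    Fin.sum_univ_three, Matrix.one_apply_eq] at *
  linear_combination hR + hQ

theorem cosAngle_le_one (R Q : SO3) : cosAngle R Q ≤ 1 := by
  have := sum_sq_entry_sub R Q
  have h : 0 ≤ ∑ i, ∑ j, (mat R i j - mat Q i j) ^ 2 := by positivity
  linarith

theorem sum_sq_row (R : SO3) (i : Fin 3) : ∑ j, mat R i j ^ 2 = 1 := by
  have := congrFun (congrFun (mat_mul_transpose R) i) i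
  simpa [Matrix.mul_apply, sq] using this

theorem abs_entry_le_one (R : SO3) (i j : Fin 3) : |mat R i j| ≤ 1 := by
  rw [← sq_le_one_iff_abs_le_one, ← sum_sq_row R i]
  exact Finset.single_le_sum (f := fun j => mat R i j ^ 2) (fun _ _ => sq_nonneg _)
    (Finset.mem_univ j)

theorem chord_sq_le (R Q : SO3) : chord R Q ^ 2 ≤ 4 * (1 - cosAngle R Q) := by
  have h0 : 0 ≤ 4 * (1 - cosAngle R Q) := by linarith [cosAngle_le_one R Q]
  have : chord R Q ≤ √(4 * (1 - cosAngle R Q)) := by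
    refine (pi_norm_le_iff_of_nonneg (Real.sqrt_nonneg _)).2 fun i =>
      (pi_norm_le_iff_of_nonneg (Real.sqrt_nonneg _)).2 fun j => ?_
    rw [Real.norm_eq_abs]
    apply Real.abs_le_sqrt
    rw [← sum_sq_entry_sub]
    refine (Finset.single_le_sum (f := fun j => (mat R i j - mat Q i j) ^ 2)
      (fun _ _ => sq_nonneg _) (Finset.mem_univ j)).trans ?_
    exact Finset.single_le_sum (f := fun i => ∑ j, (mat R i j - mat Q i j) ^ 2)
      (fun _ _ => Finset.sum_nonneg fun _ _ => sq_nonneg _) (Finset.mem_univ i)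
  calc chord R Q ^ 2 ≤ √(4 * (1 - cosAngle R Q)) ^ 2 :=
        pow_le_pow_left₀ (chord_nonneg _ _) this 2
    _ = _ := Real.sq_sqrt h0

theorem le_chord_sq (R Q : SO3) : 4 * (1 - cosAngle R Q) ≤ 9 * chord R Q ^ 2 := by
  rw [← sum_sq_entry_sub]
  calc ∑ i, ∑ j, (mat R i j - mat Q i j) ^ 2 ≤ ∑ _i : Fin 3, ∑ _j : Fin 3, chord R Q ^ 2 := by
        refine Finset.sum_le_sum fun i _ => Finset.sum_le_sum fun j _ => ?_
        rw [← sq_abs]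
        exact pow_le_pow_left₀ (abs_nonneg _) (abs_entry_sub_le_chord R Q i j) 2
    _ = 9 * chord R Q ^ 2 := by simp; ring

/-! ### Rotation angles and separation from the cut locus -/

theorem transpose_mul_orthogonal (R Q : SO3) :
    ((mat R)ᵀ * mat Q) * ((mat R)ᵀ * mat Q)ᵀ = 1 := by
  rw [Matrix.transpose_mul, Matrix.transpose_transpose, mul_assoc, ← mul_assoc (mat Q),
    mat_mul_transpose, one_mul, transpose_mul_mat]

theorem det_transpose_mul (R Q : SO3) : ((mat R)ᵀ * mat Q).det = 1 := by
  rw [Matrix.det_mul, Matrix.det_transpose, det_mat, det_mat, one_mul]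

theorem dotProduct_symmetric_part (M : Matrix (Fin 3) (Fin 3) ℝ) (c : ℝ) (v : Fin 3 → ℝ) :
    v ⬝ᵥ ((M + Mᵀ - c • (1 : Matrix (Fin 3) (Fin 3) ℝ)) *ᵥ v)
      = 2 * (v ⬝ᵥ (M *ᵥ v)) - c * (v ⬝ᵥ v) := by
  have : v ⬝ᵥ (Mᵀ *ᵥ v) = v ⬝ᵥ (M *ᵥ v) := by
    rw [Matrix.mulVec_transpose, dotProduct_comm, ← Matrix.dotProduct_mulVec]
  rw [Matrix.sub_mulVec, Matrix.add_mulVec, dotProduct_sub, dotProduct_add, this,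
    Matrix.smul_mulVec, dotProduct_smul, Matrix.one_mulVec, smul_eq_mul]
  ring

/-- A rotation turns some nonzero vector exactly by its rotation angle. -/
theorem exists_vector_turned_by_angle {M : Matrix (Fin 3) (Fin 3) ℝ} (h : M * Mᵀ = 1)
    (hd : M.det = 1) :
    ∃ v : Fin 3 → ℝ, 0 < v ⬝ᵥ v ∧ v ⬝ᵥ (M *ᵥ v) = (M.trace - 1) / 2 * (v ⬝ᵥ v) := by
  have key := symmetric_part_quadratic h hd
  by_cases hN : M + Mᵀ - 2 = 0
  · have e : M + Mᵀ - (2 : ℝ) • (1 : Matrix (Fin 3) (Fin 3) ℝ) = 0 := by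
      rw [two_smul, one_add_one_eq_two, hN]
    have ht : M.trace = 3 := by
      have := congrArg Matrix.trace e
      simp [Matrix.trace_add, Matrix.trace_sub] at this
      linarith
    refine ⟨Pi.single 0 1, by simp, ?_⟩
    have := dotProduct_symmetric_part M 2 (Pi.single 0 1)
    rw [e] at this
    rw [Matrix.zero_mulVec, dotProduct_zero] at this
    rw [ht]
    linarith
  -- By `symmetric_part_quadratic`, every row of `M + Mᵀ - 2` is annihilated by `M + Mᵀ - (M.trace -
  -- 1)`; a nonzero row is the required vector.
  · obtain ⟨i, hi⟩ : ∃ i, (M + Mᵀ - 2) i ≠ 0 := by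
      by_contra! hc
      exact hN (funext hc)
    refine ⟨(M + Mᵀ - 2) i, ?_, ?_⟩
    · refine lt_of_le_of_ne (Finset.sum_nonneg fun j _ => mul_self_nonneg _) (Ne.symm ?_)
      rwa [Ne, dotProduct_self_eq_zero]
    · have hrow : (M + Mᵀ - 2) i ᵥ*
          (M + Mᵀ - (M.trace - 1) • (1 : Matrix (Fin 3) (Fin 3) ℝ)) = 0 := by
        have := congrFun key i
        rwa [Matrix.mul_apply_eq_vecMul] at this
      have := dotProduct_symmetric_part M (M.trace - 1) ((M + Mᵀ - 2) i)
      rw [Matrix.dotProduct_mulVec, hrow, zero_dotProduct] at this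
      linarith

/-- A rotation turns every vector by at most its rotation angle. -/
theorem cosAngle_one_mul_le (R : SO3) (v : Fin 3 → ℝ) :
    cosAngle 1 R * (v ⬝ᵥ v) ≤ v ⬝ᵥ (mat R *ᵥ v) := by
  have hc : cosAngle 1 R = ((mat R).trace - 1) / 2 := by simp [cosAngle, mat]
  have hle := cosAngle_le_one 1 R
  set M := mat R
  set S := M + Mᵀ - (M.trace - 1) • (1 : Matrix (Fin 3) (Fin 3) ℝ) with hS
  have key : (M + Mᵀ - 2) * S = 0 := symmetric_part_quadratic (mat_mul_transpose R) (det_mat R)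
  -- The symmetric `S` is a nonnegative multiple of an orthogonal projection, or squares to zero
  -- when the trace is 3; either way its quadratic form is nonnegative.
  have hSS : S * S = (3 - M.trace) • S := by
    have e : S = (M + Mᵀ - 2) + (3 - M.trace) • (1 : Matrix (Fin 3) (Fin 3) ℝ) := by
      have : (2 : Matrix (Fin 3) (Fin 3) ℝ) = (2 : ℝ) • 1 := by
        rw [two_smul, one_add_one_eq_two]
      rw [hS, this]; module
    nth_rewrite 1 [e]
    rw [add_mul, key, zero_add, Matrix.smul_mul, one_mul]
  have hSt : Sᵀ = S := by
    rw [hS]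
    simp [add_comm]
  have hsq : (S *ᵥ v) ⬝ᵥ (S *ᵥ v) = (3 - M.trace) * (v ⬝ᵥ (S *ᵥ v)) := by
    rw [← smul_eq_mul, ← dotProduct_smul, ← Matrix.smul_mulVec, ← hSS, ← Matrix.mulVec_mulVec,
      Matrix.dotProduct_mulVec v, ← Matrix.mulVec_transpose, hSt]
  have h0 : 0 ≤ (S *ᵥ v) ⬝ᵥ (S *ᵥ v) := Finset.sum_nonneg fun j _ => mul_self_nonneg _
  have hpos : 0 ≤ v ⬝ᵥ (S *ᵥ v) := by
    rcases hle.lt_or_eq with hlt | heq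
    · by_contra! hneg
      nlinarith
    · have : S *ᵥ v = 0 := by
        rw [← dotProduct_self_eq_zero, hsq]
        have : 3 - M.trace = 0 := by linarith
        rw [this, zero_mul]
      rw [this, dotProduct_zero]
  rw [hS, dotProduct_symmetric_part] at hpos
  rw [hc]
  linarith

/-- With `s = cos α`, this is the triangle inequality for angles: `2 * s ^ 2 - 1 = cos 2α`. For a
vector `v` turned by exactly the angle of `Rᵀ Q`, apply Cauchy–Schwarz to `v` and `R v + Q v`. -/
theorem two_mul_sq_sub_one_le_cosAngle {s : ℝ} (hs : 0 ≤ s) {R Q : SO3}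
    (hR : s ≤ cosAngle 1 R) (hQ : s ≤ cosAngle 1 Q) : 2 * s ^ 2 - 1 ≤ cosAngle R Q := by
  obtain ⟨v, hv, hM⟩ :=
    exists_vector_turned_by_angle (transpose_mul_orthogonal R Q) (det_transpose_mul R Q)
  change _ = cosAngle R Q * _ at hM
  have norm_eq : ∀ P : SO3, (mat P *ᵥ v) ⬝ᵥ (mat P *ᵥ v) = v ⬝ᵥ v := fun P => by
    rw [Matrix.dotProduct_mulVec, ← Matrix.mulVec_transpose, Matrix.mulVec_mulVec,
      transpose_mul_mat, Matrix.one_mulVec]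
  have hRQ : (mat R *ᵥ v) ⬝ᵥ (mat Q *ᵥ v) = cosAngle R Q * (v ⬝ᵥ v) := by
    rw [← hM, dotProduct_comm, Matrix.dotProduct_mulVec, ← Matrix.mulVec_transpose,
      Matrix.mulVec_mulVec, dotProduct_comm, Matrix.dotProduct_mulVec, ← Matrix.mulVec_transpose,
      Matrix.transpose_mul, Matrix.transpose_transpose, dotProduct_comm]
  set w := mat R *ᵥ v + mat Q *ᵥ v with hw
  have hww : w ⬝ᵥ w = 2 * (1 + cosAngle R Q) * (v ⬝ᵥ v) := by
    rw [hw, dotProduct_add, add_dotProduct, add_dotProduct, norm_eq, norm_eq, hRQ,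
      dotProduct_comm (mat Q *ᵥ v), hRQ]
    ring
  have hvw : 2 * s * (v ⬝ᵥ v) ≤ v ⬝ᵥ w := by
    rw [hw, dotProduct_add]
    have h1 := cosAngle_one_mul_le R v
    have h2 := cosAngle_one_mul_le Q v
    nlinarith
  have cs : (v ⬝ᵥ w) ^ 2 ≤ (v ⬝ᵥ v) * (w ⬝ᵥ w) := by
    have := Finset.sum_mul_sq_le_sq_mul_sq Finset.univ v w
    simpa [dotProduct, sq] using this
  have h1 : (2 * s * (v ⬝ᵥ v)) ^ 2 ≤ (v ⬝ᵥ w) ^ 2 := pow_le_pow_left₀ (by positivity) hvw 2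
  rw [hww] at cs
  have h2 : 0 ≤ (v ⬝ᵥ v) ^ 2 * (2 * (1 + cosAngle R Q) - 4 * s ^ 2) := by nlinarith
  have h3 := nonneg_of_mul_nonneg_right h2 (by positivity)
  linarith

theorem sin_le_cosAngle_one {ε : ℝ} (hε : 0 < ε) (hε' : ε < Real.pi / 2) (R : Disk ε) :
    Real.sin ε ≤ cosAngle 1 R.1 := by
  by_contra! h
  have h1 := R.2
  rw [dist_eq] at h1
  have h2 := Real.arccos_le_arccos h.le
  rw [← Real.cos_pi_div_two_sub, Real.arccos_cos (by linarith) (by linarith)] at h2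
  linarith

theorem disk_cosAngle_ge {ε : ℝ} (hε : 0 < ε) (hε' : ε < Real.pi / 2) (R Q : Disk ε) :
    2 * Real.sin ε ^ 2 - 1 ≤ cosAngle R.1 Q.1 :=
  two_mul_sq_sub_one_le_cosAngle
    (Real.sin_pos_of_pos_of_lt_pi hε (by linarith [Real.pi_pos])).le
    (sin_le_cosAngle_one hε hε' R) (sin_le_cosAngle_one hε hε' Q)

theorem neg_one_lt_two_mul_sin_sq_sub_one {ε : ℝ} (hε : 0 < ε) (hε' : ε < Real.pi / 2) :
    -1 < 2 * Real.sin ε ^ 2 - 1 := by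
  have := Real.sin_pos_of_pos_of_lt_pi hε (by linarith [Real.pi_pos])
  nlinarith

theorem chord_le_dist {ε : ℝ} (hε : 0 < ε) (hε' : ε < Real.pi / 2) (R Q : Disk ε) :
    chord R.1 Q.1 ≤ 2 * dist R.1 Q.1 := by
  have h1 := chord_sq_le R.1 Q.1
  have hc := disk_cosAngle_ge hε hε' R Q
  have h0 := neg_one_lt_two_mul_sin_sq_sub_one hε hε'
  have h2 := Real.one_sub_sq_div_two_le_cos (x := dist R.1 Q.1)
  rw [dist_eq, Real.cos_arccos (by linarith) (cosAngle_le_one _ _)] at h2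
  rw [dist_eq]
  refine abs_le_of_sq_le_sq' ?_ (by have := Real.arccos_nonneg (cosAngle R.1 Q.1); positivity) |>.2
  nlinarith [sq_nonneg (Real.arccos (cosAngle R.1 Q.1))]

theorem dist_le_chord {ε : ℝ} (hε : 0 < ε) (hε' : ε < Real.pi / 2) (R Q : Disk ε) :
    dist R.1 Q.1 ≤ 6 * chord R.1 Q.1 := by
  have h1 := le_chord_sq R.1 Q.1
  have hc := disk_cosAngle_ge hε hε' R Q
  have h0 := neg_one_lt_two_mul_sin_sq_sub_one hε hε'
  have h2 := Real.cos_le_one_sub_mul_cos_sq (x := dist R.1 Q.1) (by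
    rw [dist_eq, abs_of_nonneg (Real.arccos_nonneg _)]; exact Real.arccos_le_pi _)
  rw [dist_eq, Real.cos_arccos (by linarith) (cosAngle_le_one _ _)] at h2
  rw [dist_eq]
  refine abs_le_of_sq_le_sq' ?_ (mul_nonneg (by norm_num) (chord_nonneg _ _)) |>.2
  -- The crude bound `π ≤ 4` gives `θ² ≤ 18 · chord²`, hence the factor 6.
  have hpi : (1 : ℝ) / 16 ≤ 1 / Real.pi ^ 2 := by
    apply one_div_le_one_div_of_le (by positivity)
    nlinarith [Real.pi_pos, Real.pi_le_four]
  have h3 : (1 : ℝ) / 16 * Real.arccos (cosAngle R.1 Q.1) ^ 2 ≤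
      1 / Real.pi ^ 2 * Real.arccos (cosAngle R.1 Q.1) ^ 2 :=
    mul_le_mul_of_nonneg_right hpi (sq_nonneg _)
  have h4 : 2 / Real.pi ^ 2 * Real.arccos (cosAngle R.1 Q.1) ^ 2 =
      2 * (1 / Real.pi ^ 2 * Real.arccos (cosAngle R.1 Q.1) ^ 2) := by ring
  nlinarith

/-! ### Regularity of functions of the angle in terms of its cosine -/

/-- `θ / sin θ` as a function of `c = cos θ`. -/
noncomputable def angleDivSin (c : ℝ) : ℝ := (Real.sinc (Real.arccos c))⁻¹

theorem angleDivSin_of_lt_one {c : ℝ} (hc : c < 1) :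
    angleDivSin c = Real.arccos c / √(1 - c ^ 2) := by
  have : Real.arccos c ≠ 0 := (Real.arccos_pos.2 hc).ne'
  rw [angleDivSin, Real.sinc_of_ne_zero this, inv_div, Real.sin_arccos]

theorem sinc_arccos_pos {c : ℝ} (hc : -1 < c) : 0 < Real.sinc (Real.arccos c) := by
  rcases lt_or_ge c 1 with h | h
  · have h0 := Real.arccos_pos.2 h
    rw [Real.sinc_of_ne_zero h0.ne', Real.sin_arccos]
    exact div_pos (Real.sqrt_pos.2 (by nlinarith)) h0
  · rw [Real.arccos_of_one_le h, Real.sinc_zero]; exact one_pos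

theorem continuousOn_angleDivSin : ContinuousOn angleDivSin (Ioi (-1)) :=
  (Real.continuous_sinc.comp Real.continuous_arccos).continuousOn.inv₀
    fun _ hc => (sinc_arccos_pos hc).ne'

theorem hasDerivAt_arccos_sq {c : ℝ} (h1 : -1 < c) (h2 : c < 1) :
    HasDerivAt (fun x => Real.arccos x ^ 2) (-2 * angleDivSin c) c := by
  have := (Real.hasDerivAt_arccos h1.ne' h2.ne).pow 2
  convert! this using 1
  rw [angleDivSin_of_lt_one h2]
  push_cast
  ring

/-- At `c = 1` the function `arccos` is not differentiable, but the derivative of its square has a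
limit from the left. A one-sided derivative suffices, since `cosAngle` never exceeds 1. -/
theorem hasDerivWithinAt_arccos_sq {c : ℝ} (h1 : -1 < c) (h2 : c ≤ 1) :
    HasDerivWithinAt (fun x => Real.arccos x ^ 2) (-2 * angleDivSin c) (Iic 1) c := by
  rcases h2.lt_or_eq with h | rfl
  · exact (hasDerivAt_arccos_sq h1 h).hasDerivWithinAt
  · have hs : Ioo (-1 : ℝ) 1 ∈ 𝓝[<] (1 : ℝ) := Ioo_mem_nhdsLT (by norm_num)
    refine hasDerivWithinAt_Iic_of_tendsto_deriv (s := Ioo (-1) 1)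
      (fun x hx => (hasDerivAt_arccos_sq hx.1 hx.2).differentiableAt.differentiableWithinAt)
      (Real.continuous_arccos.pow 2).continuousWithinAt hs ?_
    have ht : Tendsto (fun x => -2 * angleDivSin x) (𝓝[<] 1) (𝓝 (-2 * angleDivSin 1)) :=
      ((continuousOn_angleDivSin.continuousAt (Ioi_mem_nhds h1)).tendsto.const_mul _).mono_left
        nhdsWithin_le_nhds
    refine ht.congr' ?_
    filter_upwards [hs] with x hx
    exact (hasDerivAt_arccos_sq hx.1 hx.2).deriv.symm

/-- No derivative is needed at the endpoints: the Lipschitz bound on the open interval passes to the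
closure by continuity. -/
theorem exists_lipschitz_of_deriv_bound {f f' : ℝ → ℝ} {a B : ℝ} (ha : a < 1)
    (hc : ContinuousOn f (Icc a 1)) (hd : ∀ x ∈ Ioo a 1, HasDerivAt f (f' x) x)
    (hb : ∀ x ∈ Ioo a 1, |f' x| ≤ B) :
    ∀ x ∈ Icc a 1, ∀ y ∈ Icc a 1, |f x - f y| ≤ B * |x - y| := by
  have hB : 0 ≤ B := (abs_nonneg _).trans
    (hb ((a + 1) / 2) ⟨by linarith, by linarith⟩)
  have h : LipschitzOnWith ⟨B, hB⟩ f (Ioo a 1) :=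
    (convex_Ioo a 1).lipschitzOnWith_of_nnnorm_hasDerivWithin_le
      (fun x hx => (hd x hx).hasDerivWithinAt) fun x hx => hb x hx
  have h' := LipschitzOnWith.closure (by rwa [closure_Ioo ha.ne]) h
  rw [closure_Ioo ha.ne] at h'
  intro x hx y hy
  exact h'.dist_le_mul x hx y hy

theorem hasDerivAt_angleDivSin {c : ℝ} (h1 : -1 < c) (h2 : c < 1) :
    HasDerivAt angleDivSin (-(√(1 - c ^ 2) - Real.arccos c * c) / √(1 - c ^ 2) ^ 3) c := by
  have hpos : 0 < 1 - c ^ 2 := by nlinarith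
  have hs : 0 < √(1 - c ^ 2) := Real.sqrt_pos.2 hpos
  have hd : HasDerivAt (fun x => Real.arccos x / √(1 - x ^ 2))
      ((-(1 / √(1 - c ^ 2)) * √(1 - c ^ 2) - Real.arccos c * (-(2 * c) / (2 * √(1 - c ^ 2))))
        / √(1 - c ^ 2) ^ 2) c := by
    refine (Real.hasDerivAt_arccos h1.ne' h2.ne).div ?_ hs.ne'
    refine HasDerivAt.sqrt ?_ hpos.ne'
    simpa using ((hasDerivAt_id c).pow 2).const_sub 1
  have := hd.congr_of_eventuallyEq (f₁ := angleDivSin)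
    (by filter_upwards [Iio_mem_nhds h2] with x hx using angleDivSin_of_lt_one hx)
  convert! this using 1
  field_simp
  ring

/-- In terms of `c = cos θ`, the derivative of `θ / sin θ` is `-(sin θ - θ cos θ) / sin³ θ`. The
cubic bound reduces it to `(θ / sin θ)³`, which is bounded away from `θ = π`. -/
theorem abs_sin_sub_mul_cos_le {θ : ℝ} (h0 : 0 ≤ θ) (hπ : θ ≤ Real.pi) :
    |Real.sin θ - θ * Real.cos θ| ≤ θ ^ 3 := by
  have hs := Real.sin_le h0
  have hc := Real.one_sub_sq_div_two_le_cos (x := θ)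
  have hlow : θ * Real.cos θ ≤ Real.sin θ := by
    rcases lt_or_ge θ (Real.pi / 2) with h | h
    · have hcos : 0 < Real.cos θ := Real.cos_pos_of_mem_Ioo ⟨by linarith [Real.pi_pos], h⟩
      have := Real.le_tan h0 h
      rwa [Real.tan_eq_sin_div_cos, le_div_iff₀ hcos] at this
    · have h1 := Real.cos_nonpos_of_pi_div_two_le_of_le h (by linarith [Real.pi_pos])
      have h2 := Real.sin_nonneg_of_nonneg_of_le_pi h0 hπ
      nlinarith
  rw [abs_of_nonneg (by linarith)]
  have : θ * (1 - θ ^ 2 / 2) ≤ θ * Real.cos θ := mul_le_mul_of_nonneg_left hc h0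
  have h3 : 0 ≤ θ ^ 3 := by positivity
  nlinarith

theorem exists_sinc_arccos_lower_bound {a : ℝ} (ha : -1 < a) (ha1 : a < 1) :
    ∃ m > 0, ∀ c ∈ Icc a 1, m ≤ Real.sinc (Real.arccos c) := by
  obtain ⟨x, hx, hmin⟩ := isCompact_Icc.exists_isMinOn (nonempty_Icc.2 ha1.le)
    (Real.continuous_sinc.comp Real.continuous_arccos).continuousOn (s := Icc a 1)
  exact ⟨_, sinc_arccos_pos (ha.trans_le hx.1), fun c hc => hmin hc⟩

theorem exists_lipschitz_angleDivSin {a : ℝ} (ha : -1 < a) (ha1 : a < 1) :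
    ∃ B, ∀ x ∈ Icc a 1, ∀ y ∈ Icc a 1, |angleDivSin x - angleDivSin y| ≤ B * |x - y| := by
  obtain ⟨m, hm, hmin⟩ := exists_sinc_arccos_lower_bound ha ha1
  refine ⟨(m ^ 3)⁻¹, exists_lipschitz_of_deriv_bound ha1
    (continuousOn_angleDivSin.mono fun x hx => ha.trans_le hx.1)
    (fun x hx => hasDerivAt_angleDivSin (ha.trans hx.1) hx.2) fun x hx => ?_⟩
  have h1 : -1 < x := ha.trans hx.1
  have hθ := Real.arccos_pos.2 hx.2
  have hs : 0 < √(1 - x ^ 2) := Real.sqrt_pos.2 (by nlinarith [hx.2])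
  have hb := abs_sin_sub_mul_cos_le hθ.le (Real.arccos_le_pi x)
  rw [Real.sin_arccos, Real.cos_arccos h1.le hx.2.le] at hb
  have hms := hmin x ⟨hx.1.le, hx.2.le⟩
  rw [Real.sinc_of_ne_zero hθ.ne', Real.sin_arccos, le_div_iff₀ hθ] at hms
  rw [abs_div, abs_neg, abs_of_pos (pow_pos hs 3), div_le_iff₀ (pow_pos hs 3)]
  refine hb.trans ?_
  rw [le_inv_mul_iff₀ (pow_pos hm 3), ← mul_pow]
  exact pow_le_pow_left₀ (by positivity) hms 3

theorem exists_bound_angleDivSin {a : ℝ} (ha : -1 < a) :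
    ∃ B, ∀ x ∈ Icc a 1, |angleDivSin x| ≤ B :=
  isCompact_Icc.exists_bound_of_continuousOn
    (continuousOn_angleDivSin.mono fun _ hx => ha.trans_le hx.1)

theorem exists_lipschitz_arccos_sq {a : ℝ} (ha : -1 < a) (ha1 : a < 1) :
    ∃ B, ∀ x ∈ Icc a 1, ∀ y ∈ Icc a 1, |Real.arccos x ^ 2 - Real.arccos y ^ 2| ≤ B * |x - y| := by
  obtain ⟨B, hB⟩ := exists_bound_angleDivSin ha
  refine ⟨2 * B, exists_lipschitz_of_deriv_bound ha1
    (Real.continuous_arccos.pow 2).continuousOn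
    (fun x hx => hasDerivAt_arccos_sq (ha.trans hx.1) hx.2) fun x hx => ?_⟩
  rw [abs_mul, abs_neg, abs_two]
  exact mul_le_mul_of_nonneg_left (hB x ⟨hx.1.le, hx.2.le⟩) zero_le_two

/-- For `f` locally Lipschitz, `f (θ²)` is Lipschitz in `cos θ` away from `θ = π`. -/
theorem exists_lipschitz_comp_arccos_sq {f : ℝ → ℝ} (hf : LocallyLipschitzOn (Ici 0) f) {a : ℝ}
    (ha : -1 < a) (ha1 : a < 1) :
    ∃ B, ∀ x ∈ Icc a 1, ∀ y ∈ Icc a 1,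
      |f (Real.arccos x ^ 2) - f (Real.arccos y ^ 2)| ≤ B * |x - y| := by
  obtain ⟨B, hB⟩ := exists_lipschitz_arccos_sq ha ha1
  obtain ⟨C, hC⟩ := LocallyLipschitzOn.exists_lipschitzOnWith_of_compact isCompact_Icc
    (hf.mono (Icc_subset_Ici_self : Icc 0 (Real.pi ^ 2) ⊆ Ici (0 : ℝ)))
  have hmem : ∀ x, Real.arccos x ^ 2 ∈ Icc 0 (Real.pi ^ 2) := fun x =>
    ⟨sq_nonneg _, pow_le_pow_left₀ (Real.arccos_nonneg x) (Real.arccos_le_pi x) 2⟩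
  refine ⟨C * B, fun x hx y hy => ?_⟩
  have := hC.dist_le_mul _ (hmem x) _ (hmem y)
  rw [Real.dist_eq, Real.dist_eq] at this
  refine this.trans ?_
  rw [mul_assoc]
  exact mul_le_mul_of_nonneg_left (hB x hx y hy) C.2

/-! ### The Riemannian gradient of the interaction potential -/

/-- The gradient at `R` of `R ↦ g (d(R, Q)²)`, in terms of `g'`. -/
noncomputable def gradientField (g' : ℝ → ℝ) (R Q : SO3) : Matrix (Fin 3) (Fin 3) ℝ :=
  (-(g' (Real.arccos (cosAngle R Q) ^ 2) * angleDivSin (cosAngle R Q))) •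
    (mat Q - mat R * (mat Q)ᵀ * mat R)

theorem gradientField_mem_tangent (g' : ℝ → ℝ) (R Q : SO3) : gradientField g' R Q ∈ tangent R := by
  refine ⟨(-(g' (Real.arccos (cosAngle R Q) ^ 2) * angleDivSin (cosAngle R Q))) •
    ((mat R)ᵀ * mat Q - (mat Q)ᵀ * mat R), ?_, ?_⟩
  · rw [Matrix.transpose_smul, Matrix.transpose_sub, Matrix.transpose_mul, Matrix.transpose_mul,
      Matrix.transpose_transpose, Matrix.transpose_transpose, ← smul_neg, neg_sub]
  · rw [gradientField, Matrix.mul_smul, mul_sub, ← mul_assoc, mat_mul_transpose, one_mul, mul_assoc]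

theorem velocity_tangent {γ : ℝ → SO3} {W : Matrix (Fin 3) (Fin 3) ℝ} {t : ℝ}
    (h : HasVelocityWithinAt γ W univ t) : Wᵀ * mat (γ t) + (mat (γ t))ᵀ * W = 0 := by
  ext i j
  have hd : HasDerivAt (fun u => ∑ k, mat (γ u) k i * mat (γ u) k j)
      (∑ k, (W k i * mat (γ t) k j + mat (γ t) k i * W k j)) t :=
    HasDerivAt.fun_sum fun k _ =>
      (hasDerivWithinAt_univ.1 (h k i)).mul (hasDerivWithinAt_univ.1 (h k j))
  have hconst : (fun u => ∑ k, mat (γ u) k i * mat (γ u) k j) =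
      fun _ => (1 : Matrix (Fin 3) (Fin 3) ℝ) i j := by
    funext u
    rw [← transpose_mul_mat (γ u)]
    simp [Matrix.mul_apply]
  rw [hconst] at hd
  have := hd.unique (hasDerivAt_const t _)
  simpa [Matrix.mul_apply, Finset.sum_add_distrib] using this

theorem hasDerivAt_cosAngle {γ : ℝ → SO3} {W : Matrix (Fin 3) (Fin 3) ℝ} {t : ℝ}
    (h : HasVelocityWithinAt γ W univ t) (Q : SO3) :
    HasDerivAt (fun u => cosAngle (γ u) Q) ((Wᵀ * mat Q).trace / 2) t := by
  have hd : HasDerivAt (fun u => ∑ i, ∑ k, mat (γ u) k i * mat Q k i)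
      (∑ i, ∑ k, W k i * mat Q k i) t :=
    HasDerivAt.fun_sum fun i _ => HasDerivAt.fun_sum fun k _ =>
      (hasDerivWithinAt_univ.1 (h k i)).mul_const _
  have := (hd.sub_const 1).div_const 2
  simpa [cosAngle, Matrix.trace, Matrix.mul_apply] using! this

/-- Since `Rᵀ W` is skew, the two terms of `Q - R Qᵀ R` pair equally with `W`; this doubling cancels
the factor `1/2` of the metric. -/
theorem metric_gradientField (g' : ℝ → ℝ) (R Q : SO3) {W : Matrix (Fin 3) (Fin 3) ℝ}
    (hW : Wᵀ * mat R + (mat R)ᵀ * W = 0) :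
    metric (gradientField g' R Q) W =
      g' (Real.arccos (cosAngle R Q) ^ 2) * (-2 * angleDivSin (cosAngle R Q) *
        ((Wᵀ * mat Q).trace / 2)) := by
  have h1 : ((mat R * (mat Q)ᵀ * mat R)ᵀ * W).trace = -(Wᵀ * mat Q).trace := by
    have e : (mat R)ᵀ * W = -(Wᵀ * mat R) := by rw [eq_neg_iff_add_eq_zero, add_comm, hW]
    calc ((mat R * (mat Q)ᵀ * mat R)ᵀ * W).trace
        = ((mat R)ᵀ * (mat Q * ((mat R)ᵀ * W))).trace := by
          simp only [Matrix.transpose_mul, Matrix.transpose_transpose, mul_assoc]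
      _ = -((mat R)ᵀ * (mat Q * (Wᵀ * mat R))).trace := by
          rw [e, mul_neg, mul_neg, Matrix.trace_neg]
      _ = -(mat Q * Wᵀ).trace := by
          rw [Matrix.trace_mul_comm, mul_assoc, mul_assoc, mat_mul_transpose, mul_one]
      _ = -(Wᵀ * mat Q).trace := by rw [Matrix.trace_mul_comm]
  have h2 : ((mat Q)ᵀ * W).trace = (Wᵀ * mat Q).trace := by
    rw [← Matrix.trace_transpose, Matrix.transpose_mul, Matrix.transpose_transpose]
  rw [metric, gradientField, Matrix.transpose_smul, Matrix.smul_mul, Matrix.trace_smul,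
    Matrix.transpose_sub, sub_mul, Matrix.trace_sub, h1, h2, smul_eq_mul]
  ring

/-- The chain rule is used with one-sided derivatives of `g` and `arccos²`, legitimate because the
inner functions stay in `[0, ∞)` and `(-∞, 1]`. -/
theorem isGradientAt_gradientField {g g' : ℝ → ℝ}
    (hg : ∀ x ∈ Ici (0 : ℝ), HasDerivWithinAt g (g' x) (Ici 0) x) {R Q : SO3}
    (hRQ : -1 < cosAngle R Q) :
    IsGradientAt (fun R' => g (dist R' Q ^ 2)) R (gradientField g' R Q) := by
  refine ⟨gradientField_mem_tangent g' R Q, fun γ W hγ hW => ?_⟩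
  subst hγ
  rw [metric_gradientField g' _ Q (velocity_tangent hW)]
  have h1 : HasDerivAt (fun u => Real.arccos (cosAngle (γ u) Q) ^ 2)
      (-2 * angleDivSin (cosAngle (γ 0) Q) * ((Wᵀ * mat Q).trace / 2)) 0 :=
    HasDerivWithinAt.comp_hasDerivAt (h₂ := fun x => Real.arccos x ^ 2) 0
      (hasDerivWithinAt_arccos_sq hRQ (cosAngle_le_one _ _))
      (hasDerivAt_cosAngle hW Q) (Eventually.of_forall fun u => cosAngle_le_one _ _)
  exact HasDerivWithinAt.comp_hasDerivAt (h₂ := g) 0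
    (hg _ (sq_nonneg (Real.arccos (cosAngle (γ 0) Q)))) h1
    (Eventually.of_forall fun u => sq_nonneg (Real.arccos (cosAngle (γ u) Q)))

section Exponential

open scoped Matrix.Norms.Operator

theorem exp_skew_mem {A : Matrix (Fin 3) (Fin 3) ℝ} (hA : Aᵀ = -A) :
    NormedSpace.exp A ∈ Matrix.specialOrthogonalGroup (Fin 3) ℝ := by
  have orth : ∀ B : Matrix (Fin 3) (Fin 3) ℝ, Bᵀ = -B →
      NormedSpace.exp B * (NormedSpace.exp B)ᵀ = 1 := fun B hB => by
    rw [← Matrix.exp_transpose, hB, ← Matrix.exp_add_of_commute _ _ (Commute.neg_right (Commute.refl B)),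
      add_neg_cancel, NormedSpace.exp_zero]
  refine Matrix.mem_specialOrthogonalGroup_iff.2
    ⟨(Matrix.mem_orthogonalGroup_iff _ _).2 (orth A hA), ?_⟩
  -- Halving gives `det (exp A) = (det (exp B))²`, which is 1 by orthogonality of `exp B`.
  set B := (1 / 2 : ℝ) • A with hB
  have hBt : Bᵀ = -B := by rw [hB, Matrix.transpose_smul, hA, smul_neg]
  have hAB : A = B + B := by rw [hB, ← add_smul]; norm_num
  have h := congrArg Matrix.det (orth B hBt)
  rw [Matrix.det_mul, Matrix.det_transpose, Matrix.det_one] at h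
  rw [hAB, Matrix.exp_add_of_commute _ _ rfl, Matrix.det_mul, h]

theorem exists_curve_with_velocity {R : SO3} {W : Matrix (Fin 3) (Fin 3) ℝ} (hW : W ∈ tangent R) :
    ∃ γ : ℝ → SO3, γ 0 = R ∧ HasVelocityWithinAt γ W univ 0 := by
  obtain ⟨A, hA, rfl⟩ := hW
  have hmem : ∀ t : ℝ, NormedSpace.exp (t • A) ∈ Matrix.specialOrthogonalGroup (Fin 3) ℝ :=
    fun t => exp_skew_mem (by rw [Matrix.transpose_smul, hA, smul_neg])
  refine ⟨fun t => R * ⟨NormedSpace.exp (t • A), hmem t⟩, ?_, fun i j => ?_⟩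
  · ext1
    simp [NormedSpace.exp_zero]
  · rw [hasDerivWithinAt_univ]
    have h := (hasDerivAt_exp_smul_const (𝕂 := ℝ) A (0 : ℝ)).const_mul (mat R)
    rw [zero_smul, NormedSpace.exp_zero, one_mul] at h
    exact (LinearMap.toContinuousLinearMap
      (Matrix.entryLinearMap ℝ ℝ i j)).hasFDerivAt.comp_hasDerivAt (0 : ℝ) h

end Exponential

/-- Testing both gradients along a curve with velocity `V - V'` forces this vector to have norm
zero. Uniqueness identifies the chosen value in `gradient`. -/
theorem IsGradientAt.unique {R : SO3} {V V' : Matrix (Fin 3) (Fin 3) ℝ} {φ : SO3 → ℝ}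
    (h : IsGradientAt φ R V) (h' : IsGradientAt φ R V') : V = V' := by
  obtain ⟨A, hA, eA⟩ := h.1
  obtain ⟨B, hB, eB⟩ := h'.1
  have hW : V - V' ∈ tangent R :=
    ⟨A - B, by rw [Matrix.transpose_sub, hA, hB]; abel, by rw [eA, eB, mul_sub]⟩
  obtain ⟨γ, hγ, hv⟩ := exists_curve_with_velocity hW
  have key := (h.2 γ _ hγ hv).unique (h'.2 γ _ hγ hv)
  have h0 : ((V - V')ᵀ * (V - V')).trace = 0 := by
    rw [metric, metric] at key
    rw [Matrix.transpose_sub, sub_mul, Matrix.trace_sub]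
    linarith
  have := (Matrix.trace_conjTranspose_mul_self_eq_zero_iff (A := V - V')).1
    (by rwa [Matrix.conjTranspose_eq_transpose_of_trivial])
  exact sub_eq_zero.1 this

theorem gradient_eq {g g' : ℝ → ℝ} {K : SO3 → SO3 → ℝ}
    (hg : ∀ x ∈ Ici (0 : ℝ), HasDerivWithinAt g (g' x) (Ici 0) x)
    (hK : ∀ R Q, K R Q = g (dist R Q ^ 2)) {R Q : SO3} (hRQ : -1 < cosAngle R Q) :
    gradient (fun R' => K R' Q) R = gradientField g' R Q := by
  have h : IsGradientAt (fun R' => K R' Q) R (gradientField g' R Q) := by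
    simpa only [hK] using isGradientAt_gradientField hg hRQ
  have hex : ∃ V, IsGradientAt (fun R' => K R' Q) R V := ⟨_, h⟩
  rw [gradient, dif_pos hex]
  exact IsGradientAt.unique hex.choose_spec h

/-! ### Bounded Lipschitz functions on the disk -/

/-- Every rotation has entries in `[-1, 1]`, so the chordal distance is bounded. -/
theorem chord_le_two (R Q : SO3) : chord R Q ≤ 2 := by
  refine (pi_norm_le_iff_of_nonneg zero_le_two).2 fun i =>
    (pi_norm_le_iff_of_nonneg zero_le_two).2 fun j => ?_
  rw [Real.norm_eq_abs]
  refine (abs_sub _ _).trans ?_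
  linarith [abs_entry_le_one R i j, abs_entry_le_one Q i j]

/-- `F` is bounded and Lipschitz with respect to the chordal distance. -/
def BoundedLipschitz {ε : ℝ} (F : Disk ε → Disk ε → ℝ) : Prop :=
  ∃ B, 0 ≤ B ∧ (∀ R Q, |F R Q| ≤ B) ∧
    ∀ R Q R' Q', |F R Q - F R' Q'| ≤ B * (chord R.1 R'.1 + chord Q.1 Q'.1)

namespace BoundedLipschitz

variable {ε : ℝ} {F G : Disk ε → Disk ε → ℝ}

theorem const (c : ℝ) : BoundedLipschitz (fun _ _ : Disk ε => c) :=
  ⟨|c|, abs_nonneg c, fun _ _ => le_rfl, fun R Q R' Q' => by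
    rw [sub_self, abs_zero]
    exact mul_nonneg (abs_nonneg c) (add_nonneg (chord_nonneg _ _) (chord_nonneg _ _))⟩

theorem fst (i j : Fin 3) : BoundedLipschitz (fun R _ : Disk ε => mat R.1 i j) :=
  ⟨1, zero_le_one, fun R _ => abs_entry_le_one R.1 i j, fun R Q R' Q' => by
    linarith [abs_entry_sub_le_chord R.1 R'.1 i j, chord_nonneg Q.1 Q'.1]⟩

theorem snd (i j : Fin 3) : BoundedLipschitz (fun _ Q : Disk ε => mat Q.1 i j) :=
  ⟨1, zero_le_one, fun _ Q => abs_entry_le_one Q.1 i j, fun R Q R' Q' => by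
    linarith [abs_entry_sub_le_chord Q.1 Q'.1 i j, chord_nonneg R.1 R'.1]⟩

theorem add (hF : BoundedLipschitz F) (hG : BoundedLipschitz G) :
    BoundedLipschitz fun R Q => F R Q + G R Q := by
  obtain ⟨B, hB, h1, h2⟩ := hF
  obtain ⟨C, hC, h3, h4⟩ := hG
  refine ⟨B + C, add_nonneg hB hC, fun R Q => (abs_add_le _ _).trans (add_le_add (h1 R Q) (h3 R Q)),
    fun R Q R' Q' => ?_⟩
  rw [add_sub_add_comm, add_mul]
  exact (abs_add_le _ _).trans (add_le_add (h2 R Q R' Q') (h4 R Q R' Q'))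

theorem mul (hF : BoundedLipschitz F) (hG : BoundedLipschitz G) :
    BoundedLipschitz fun R Q => F R Q * G R Q := by
  obtain ⟨B, hB, h1, h2⟩ := hF
  obtain ⟨C, hC, h3, h4⟩ := hG
  refine ⟨2 * (B * C), by positivity, fun R Q => ?_, fun R Q R' Q' => ?_⟩
  · rw [abs_mul]
    have := mul_le_mul (h1 R Q) (h3 R Q) (abs_nonneg _) hB
    nlinarith [mul_nonneg hB hC]
  · have e : F R Q * G R Q - F R' Q' * G R' Q' =
        F R Q * (G R Q - G R' Q') + (F R Q - F R' Q') * G R' Q' := by ring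
    rw [e]
    refine (abs_add_le _ _).trans ?_
    rw [abs_mul, abs_mul]
    have a := mul_le_mul (h1 R Q) (h4 R Q R' Q') (abs_nonneg _) hB
    have b := mul_le_mul (h2 R Q R' Q') (h3 R' Q') (abs_nonneg _) ((abs_nonneg _).trans (h2 R Q R' Q'))
    linarith

theorem neg (hF : BoundedLipschitz F) : BoundedLipschitz fun R Q => -F R Q := by
  simpa using (const (-1)).mul hF

theorem sub (hF : BoundedLipschitz F) (hG : BoundedLipschitz G) :
    BoundedLipschitz fun R Q => F R Q - G R Q := by
  simpa only [sub_eq_add_neg] using hF.add hG.neg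

theorem sum {ι : Type*} (s : Finset ι) {H : ι → Disk ε → Disk ε → ℝ}
    (h : ∀ i ∈ s, BoundedLipschitz (H i)) : BoundedLipschitz fun R Q => ∑ i ∈ s, H i R Q := by
  classical
  induction s using Finset.induction_on with
  | empty => simpa using const (ε := ε) 0
  | insert a s ha ih =>
    simp only [Finset.sum_insert ha]
    exact (h a (Finset.mem_insert_self a s)).add
      (ih fun i hi => h i (Finset.mem_insert_of_mem hi))

theorem comp (hF : BoundedLipschitz F) {f : ℝ → ℝ} {S : Set ℝ} {B : ℝ}
    (hS : ∀ R Q, F R Q ∈ S) (hb : ∀ x ∈ S, |f x| ≤ B)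
    (hl : ∀ x ∈ S, ∀ y ∈ S, |f x - f y| ≤ B * |x - y|) :
    BoundedLipschitz fun R Q => f (F R Q) := by
  obtain ⟨C, hC, h1, h2⟩ := hF
  refine ⟨|B| + |B| * C, by positivity, fun R Q => ?_, fun R Q R' Q' => ?_⟩
  · have := hb _ (hS R Q)
    have := le_abs_self B
    have : 0 ≤ |B| * C := by positivity
    linarith
  · have hd := add_nonneg (chord_nonneg R.1 R'.1) (chord_nonneg Q.1 Q'.1)
    calc |f (F R Q) - f (F R' Q')| ≤ B * |F R Q - F R' Q'| := hl _ (hS R Q) _ (hS R' Q')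
      _ ≤ |B| * |F R Q - F R' Q'| := mul_le_mul_of_nonneg_right (le_abs_self B) (abs_nonneg _)
      _ ≤ |B| * (C * (chord R.1 R'.1 + chord Q.1 Q'.1)) :=
        mul_le_mul_of_nonneg_left (h2 R Q R' Q') (abs_nonneg _)
      _ ≤ _ := by nlinarith [abs_nonneg B, mul_nonneg (abs_nonneg B) hd]

theorem continuous (hF : BoundedLipschitz F) (R : Disk ε) : Continuous (F R) := by
  obtain ⟨B, -, -, h⟩ := hF
  refine continuous_iff_continuousAt.2 fun Q => ?_
  rw [ContinuousAt, tendsto_iff_dist_tendsto_zero]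
  have hc : Tendsto (fun P : Disk ε => B * chord P.1 Q.1) (𝓝 Q) (𝓝 (B * chord Q.1 Q.1)) := by
    have hq : Continuous fun P : Disk ε => chord P.1 Q.1 :=
      continuous_chord continuous_subtype_val continuous_const
    exact (hq.tendsto Q).const_mul B
  have h0 : ∀ P : SO3, chord P P = 0 := fun P => by
    simp only [chord, sub_self]
    exact norm_zero
  rw [h0, mul_zero] at hc
  refine squeeze_zero (fun _ => dist_nonneg) (fun P => ?_) hc
  have := h R P R Q
  rwa [h0, zero_add] at this

end BoundedLipschitz

theorem boundedLipschitz_cosAngle {ε : ℝ} :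
    BoundedLipschitz fun R Q : Disk ε => cosAngle R.1 Q.1 := by
  have h : BoundedLipschitz fun R Q : Disk ε =>
      ((∑ i, ∑ k, mat R.1 k i * mat Q.1 k i) - 1) * (1 / 2) :=
    ((BoundedLipschitz.sum _ fun i _ => BoundedLipschitz.sum _ fun k _ =>
      (BoundedLipschitz.fst k i).mul (BoundedLipschitz.snd k i)).sub (.const 1)).mul (.const _)
  simpa [cosAngle, Matrix.trace, Matrix.mul_apply, div_eq_mul_inv] using! h

theorem bounded_of_lipschitz {f : ℝ → ℝ} {a B : ℝ} (ha1 : a < 1)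
    (h : ∀ x ∈ Icc a 1, ∀ y ∈ Icc a 1, |f x - f y| ≤ B * |x - y|) :
    ∀ x ∈ Icc a 1, |f x| ≤ |f 1| + |B| * (1 - a) := by
  intro x hx
  have h1 := h x hx 1 ⟨ha1.le, le_rfl⟩
  have h2 := abs_sub_abs_le_abs_sub (f x) (f 1)
  have h3 : B * |x - 1| ≤ |B| * (1 - a) := by
    refine (mul_le_mul_of_nonneg_right (le_abs_self B) (abs_nonneg _)).trans
      (mul_le_mul_of_nonneg_left ?_ (abs_nonneg B))
    rw [abs_of_nonpos (by linarith [hx.2])]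
    linarith [hx.1]
  linarith

/-- On the disk `cosAngle` takes values in `[2 sin² ε - 1, 1]`, a compact interval avoiding `-1`. -/
theorem boundedLipschitz_comp_cosAngle {ε : ℝ} (hε : 0 < ε) (hε' : ε < Real.pi / 2) {f : ℝ → ℝ}
    (hf : ∀ a : ℝ, -1 < a → a < 1 →
      ∃ B, ∀ x ∈ Icc a 1, ∀ y ∈ Icc a 1, |f x - f y| ≤ B * |x - y|) :
    BoundedLipschitz fun R Q : Disk ε => f (cosAngle R.1 Q.1) := by
  have ha := neg_one_lt_two_mul_sin_sq_sub_one hε hε'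
  have ha1 : 2 * Real.sin ε ^ 2 - 1 < 1 := by
    have h1 := Real.sin_sq_add_cos_sq ε
    have h2 := Real.cos_pos_of_mem_Ioo ⟨by linarith [Real.pi_pos], hε'⟩
    nlinarith
  obtain ⟨B, hB⟩ := hf _ ha ha1
  have hb := bounded_of_lipschitz ha1 hB
  refine boundedLipschitz_cosAngle.comp (S := Icc (2 * Real.sin ε ^ 2 - 1) 1)
    (B := max B (|f 1| + |B| * (1 - (2 * Real.sin ε ^ 2 - 1))))
    (fun R Q => ⟨disk_cosAngle_ge hε hε' R Q, cosAngle_le_one _ _⟩)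
    (fun x hx => (hb x hx).trans (le_max_right _ _)) fun x hx y hy => (hB x hx y hy).trans ?_
  exact mul_le_mul_of_nonneg_right (le_max_left _ _) (abs_nonneg _)

theorem boundedLipschitz_gradientField {ε : ℝ} (hε : 0 < ε) (hε' : ε < Real.pi / 2) {g' : ℝ → ℝ}
    (hg' : LocallyLipschitzOn (Ici 0) g') (i j : Fin 3) :
    BoundedLipschitz fun R Q : Disk ε => gradientField g' R.1 Q.1 i j := by
  have h1 : BoundedLipschitz fun R Q : Disk ε => g' (Real.arccos (cosAngle R.1 Q.1) ^ 2) :=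
    boundedLipschitz_comp_cosAngle hε hε' (f := fun c => g' (Real.arccos c ^ 2))
      fun a ha ha1 => exists_lipschitz_comp_arccos_sq hg' ha ha1
  have h2 : BoundedLipschitz fun R Q : Disk ε => angleDivSin (cosAngle R.1 Q.1) :=
    boundedLipschitz_comp_cosAngle hε hε' fun a ha ha1 => exists_lipschitz_angleDivSin ha ha1
  have h3 : BoundedLipschitz fun R Q : Disk ε =>
      mat Q.1 i j - ∑ k, (∑ l, mat R.1 i l * mat Q.1 k l) * mat R.1 k j :=
    (BoundedLipschitz.snd i j).sub (.sum _ fun k _ =>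
      (BoundedLipschitz.sum _ fun l _ => (BoundedLipschitz.fst i l).mul (.snd k l)).mul (.fst k j))
  simpa [gradientField, Matrix.mul_apply] using! (h1.mul h2).neg.mul h3

/-- The gradient of the interaction potential is bounded and Lipschitz on the disk. -/
theorem boundedLipschitz_gradient {ε : ℝ} (hε : 0 < ε) (hε' : ε < Real.pi / 2)
    {K : SO3 → SO3 → ℝ} (hK : IsInteractionPotential K) (i j : Fin 3) :
    BoundedLipschitz fun R Q : Disk ε => gradient (fun R' => K R' Q.1) R.1 i j := by
  obtain ⟨g, g', hg, hg', hKg⟩ := hK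
  have e : ∀ R Q : Disk ε, gradient (fun R' => K R' Q.1) R.1 = gradientField g' R.1 Q.1 :=
    fun R Q => gradient_eq hg hKg ((neg_one_lt_two_mul_sin_sq_sub_one hε hε').trans_le
      (disk_cosAngle_ge hε hε' R Q))
  simpa only [e] using boundedLipschitz_gradientField hε hε' hg' i j

/-! ### Stability of the velocity, the trajectories and the Wasserstein distance -/

/-- Second countability makes continuous functions on `Disk ε × Disk ε` measurable for the product
σ-algebra and gives supports full measure. -/
instance instSecondCountableTopologySO3 : SecondCountableTopology SO3 :=
  inferInstanceAs (SecondCountableTopology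
    {R : Fin 3 → Fin 3 → ℝ // R ∈ Matrix.specialOrthogonalGroup (Fin 3) ℝ})

instance instSecondCountableTopologyDisk (ε : ℝ) : SecondCountableTopology (Disk ε) :=
  TopologicalSpace.Subtype.secondCountableTopology _

section

variable {ε : ℝ}

theorem continuous_disk_chord : Continuous fun p : Disk ε × Disk ε => chord p.1.1 p.2.1 :=
  continuous_chord (continuous_subtype_val.comp continuous_fst)
    (continuous_subtype_val.comp continuous_snd)

theorem integrable_chord (π : Measure (Disk ε × Disk ε)) [IsFiniteMeasure π] :
    Integrable (fun p => chord p.1.1 p.2.1) π :=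
  Integrable.of_bound continuous_disk_chord.aestronglyMeasurable 2
    (Eventually.of_forall fun p => by
      rw [Real.norm_eq_abs, abs_of_nonneg (chord_nonneg _ _)]; exact chord_le_two _ _)

theorem isProbabilityMeasure_of_map_fst {μ : ProbabilityMeasure (Disk ε)}
    {π : Measure (Disk ε × Disk ε)} (h : π.map Prod.fst = (μ : Measure (Disk ε))) :
    IsProbabilityMeasure π := by
  refine ⟨?_⟩
  have := congrArg (fun m => m univ) h
  simpa [Measure.map_apply measurable_fst MeasurableSet.univ] using this

/-- Stability of the velocity in the position and, through a transport plan, in the measure. -/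
theorem exists_velocity_lipschitz (hε : 0 < ε) (hε' : ε < Real.pi / 2) {K : SO3 → SO3 → ℝ}
    (hK : IsInteractionPotential K) :
    ∃ B, 0 < B ∧ ∀ (μ ν : ProbabilityMeasure (Disk ε)) (π : Measure (Disk ε × Disk ε)),
      π.map Prod.fst = (μ : Measure (Disk ε)) → π.map Prod.snd = (ν : Measure (Disk ε)) →
      ∀ (R Q : Disk ε) (i j : Fin 3), |velocity K μ R i j - velocity K ν Q i j| ≤
        B * (chord R.1 Q.1 + ∫ p, chord p.1.1 p.2.1 ∂π) := by
  choose B hB hb hl using fun i j => boundedLipschitz_gradient hε hε' hK i j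
  have hsum : ∀ i j, B i j ≤ ∑ k, ∑ l, B k l := fun i j =>
    (Finset.single_le_sum (f := fun l => B i l) (fun l _ => hB i l) (Finset.mem_univ j)).trans
      (Finset.single_le_sum (f := fun k => ∑ l, B k l)
        (fun k _ => Finset.sum_nonneg fun l _ => hB k l) (Finset.mem_univ i))
  refine ⟨∑ k, ∑ l, B k l + 1, add_pos_of_nonneg_of_pos
    (Finset.sum_nonneg fun k _ => Finset.sum_nonneg fun l _ => hB k l) one_pos, ?_⟩
  intro μ ν π hμ hν R Q i j
  have hprob := isProbabilityMeasure_of_map_fst hμ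
  have hcont := (boundedLipschitz_gradient hε hε' hK i j).continuous
  set G : Disk ε → Disk ε → ℝ := fun R Q => gradient (fun R' => K R' Q.1) R.1 i j
  -- The marginals turn both velocities into integrals against the same plan, so the integrands can
  -- be compared pointwise.
  have e1 : velocity K μ R i j = -∫ p, G R p.1 ∂π := by
    change -∫ P, G R P ∂(μ : Measure (Disk ε)) = _
    rw [← hμ, integral_map measurable_fst.aemeasurable (hcont R).aestronglyMeasurable]
  have e2 : velocity K ν Q i j = -∫ p, G Q p.2 ∂π := by
    change -∫ P, G Q P ∂(ν : Measure (Disk ε)) = _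
    rw [← hν, integral_map measurable_snd.aemeasurable (hcont Q).aestronglyMeasurable]
  have i1 : Integrable (fun p : Disk ε × Disk ε => G R p.1) π :=
    Integrable.of_bound ((hcont R).comp continuous_fst).aestronglyMeasurable (B i j)
      (Eventually.of_forall fun p => hb i j R p.1)
  have i2 : Integrable (fun p : Disk ε × Disk ε => G Q p.2) π :=
    Integrable.of_bound ((hcont Q).comp continuous_snd).aestronglyMeasurable (B i j)
      (Eventually.of_forall fun p => hb i j Q p.2)
  have i3 := integrable_chord π
  have hint0 : 0 ≤ ∫ p, chord p.1.1 p.2.1 ∂π := integral_nonneg fun p => chord_nonneg _ _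
  rw [e1, e2, neg_sub_neg, abs_sub_comm, ← integral_sub i1 i2]
  calc |∫ p, G R p.1 - G Q p.2 ∂π| ≤ ∫ p, |G R p.1 - G Q p.2| ∂π := abs_integral_le_integral_abs
    _ ≤ ∫ p, B i j * (chord R.1 Q.1 + chord p.1.1 p.2.1) ∂π :=
      integral_mono (i1.sub i2).abs (((integrable_const _).add i3).const_mul _)
        fun p => hl i j R p.1 Q p.2
    _ = B i j * (chord R.1 Q.1 + ∫ p, chord p.1.1 p.2.1 ∂π) := by
      rw [integral_const_mul, integral_add (integrable_const _) i3, integral_const]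
      simp
    _ ≤ _ := mul_le_mul_of_nonneg_right ((hsum i j).trans (by linarith))
      (add_nonneg (chord_nonneg _ _) hint0)

/-- Grönwall's estimate for two curves over a short time. -/
theorem chord_le_of_velocity_le {T : EReal} {τ B M : ℝ} (hτ : Icc 0 τ ⊆ timeInterval T)
    (hB : 0 < B) (hBτ : Real.exp (B * τ) ≤ 3 / 2) (hM : 0 ≤ M) {x y : ℝ → SO3}
    {V W : ℝ → Matrix (Fin 3) (Fin 3) ℝ}
    (hx : ∀ t ∈ timeInterval T, HasVelocityWithinAt x (V t) (timeInterval T) t)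
    (hy : ∀ t ∈ timeInterval T, HasVelocityWithinAt y (W t) (timeInterval T) t)
    (hVW : ∀ t ∈ Icc 0 τ, ∀ i j, |V t i j - W t i j| ≤ B * (chord (x t) (y t) + M)) :
    ∀ t ∈ Icc 0 τ, chord (x t) (y t) ≤ 3 / 2 * chord (x 0) (y 0) + M / 2 := by
  have hd : ∀ t ∈ timeInterval T, HasDerivWithinAt
      (fun u => (fun i j => mat (x u) i j - mat (y u) i j : Fin 3 → Fin 3 → ℝ))
      (fun i j => V t i j - W t i j) (timeInterval T) t := fun t ht =>
    hasDerivWithinAt_pi.2 fun i => hasDerivWithinAt_pi.2 fun j => (hx t ht i j).sub (hy t ht i j)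
  intro t ht
  have key := norm_le_gronwallBound_of_norm_deriv_right_le (K := B) (ε := B * M) (b := τ)
    (fun t ht => ((hd t (hτ ht)).continuousWithinAt.mono hτ))
    (fun t ht => (hd t (hτ (Ico_subset_Icc_self ht))).mono_of_mem_nhdsWithin
      (mem_of_superset (Ico_mem_nhdsGE ht.2) fun s hs => hτ ⟨ht.1.trans hs.1, hs.2.le⟩))
    (le_refl _) (fun t ht => by
      have h0 : 0 ≤ B * (chord (x t) (y t) + M) :=
        mul_nonneg hB.le (add_nonneg (chord_nonneg _ _) hM)
      rw [← mul_add]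
      exact (pi_norm_le_iff_of_nonneg h0).2 fun i => (pi_norm_le_iff_of_nonneg h0).2 fun j =>
        hVW t (Ico_subset_Icc_self ht) i j) t ht
  -- The forcing `B * M` contributes `M (exp (B t) - 1)`, at most `M / 2`.
  rw [gronwallBound_of_K_ne_0 hB.ne', sub_zero, mul_div_cancel_left₀ _ hB.ne'] at key
  have hexp : Real.exp (B * t) ≤ 3 / 2 :=
    (Real.exp_le_exp.2 (mul_le_mul_of_nonneg_left ht.2 hB.le)).trans hBτ
  refine key.trans ?_
  change chord (x 0) (y 0) * _ + _ ≤ _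
  have := mul_le_mul_of_nonneg_left hexp (chord_nonneg (x 0) (y 0))
  have := mul_le_mul_of_nonneg_left hexp hM
  linarith

/-- `Measure.map` is zero for a map that is not a.e. measurable, and a probability measure is not
zero. -/
theorem aemeasurable_of_map_eq {μ ν : ProbabilityMeasure (Disk ε)} {Ψ : Disk ε → Disk ε}
    (h : (ν : Measure (Disk ε)) = Measure.map Ψ μ) : AEMeasurable Ψ (μ : Measure (Disk ε)) := by
  by_contra hc
  rw [Measure.map_of_not_aemeasurable hc] at h
  exact IsProbabilityMeasure.ne_zero (ν : Measure (Disk ε)) h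

/-- The push-forward of a transport plan. -/
theorem map_prodMap_marginals {μ ν μ' ν' : ProbabilityMeasure (Disk ε)} {Φ Ψ : Disk ε → Disk ε}
    (hΦ : (μ' : Measure (Disk ε)) = Measure.map Φ μ) (hΨ : (ν' : Measure (Disk ε)) = Measure.map Ψ ν)
    {π : Measure (Disk ε × Disk ε)} (h1 : π.map Prod.fst = (μ : Measure (Disk ε)))
    (h2 : π.map Prod.snd = (ν : Measure (Disk ε))) :
    AEMeasurable (fun p => (Φ p.1, Ψ p.2)) π ∧
    (π.map fun p => (Φ p.1, Ψ p.2)).map Prod.fst = (μ' : Measure (Disk ε)) ∧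
    (π.map fun p => (Φ p.1, Ψ p.2)).map Prod.snd = (ν' : Measure (Disk ε)) := by
  have a1 : AEMeasurable Φ (π.map Prod.fst) := by rw [h1]; exact aemeasurable_of_map_eq hΦ
  have a2 : AEMeasurable Ψ (π.map Prod.snd) := by rw [h2]; exact aemeasurable_of_map_eq hΨ
  have a : AEMeasurable (fun p : Disk ε × Disk ε => (Φ p.1, Ψ p.2)) π :=
    (a1.comp_measurable measurable_fst).prodMk (a2.comp_measurable measurable_snd)
  refine ⟨a, ?_, ?_⟩
  · rw [AEMeasurable.map_map_of_aemeasurable measurable_fst.aemeasurable a, hΦ, ← h1,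
      AEMeasurable.map_map_of_aemeasurable a1 measurable_fst.aemeasurable]
    rfl
  · rw [AEMeasurable.map_map_of_aemeasurable measurable_snd.aemeasurable a, hΨ, ← h2,
      AEMeasurable.map_map_of_aemeasurable a2 measurable_snd.aemeasurable]
    rfl

theorem lintegral_chord (π : Measure (Disk ε × Disk ε)) [IsFiniteMeasure π] :
    ∫⁻ p, ENNReal.ofReal (chord p.1.1 p.2.1) ∂π =
      ENNReal.ofReal (∫ p, chord p.1.1 p.2.1 ∂π) :=
  (ofReal_integral_eq_lintegral_ofReal (integrable_chord π)
    (Eventually.of_forall fun _ => chord_nonneg _ _)).symm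

theorem W1_le_of_plan (hε : 0 < ε) (hε' : ε < Real.pi / 2) {μ ν : ProbabilityMeasure (Disk ε)}
    {π : Measure (Disk ε × Disk ε)} (h1 : π.map Prod.fst = (μ : Measure (Disk ε)))
    (h2 : π.map Prod.snd = (ν : Measure (Disk ε))) :
    W1 μ ν ≤ ENNReal.ofReal (6 * ∫ p, chord p.1.1 p.2.1 ∂π) := by
  have := isProbabilityMeasure_of_map_fst h1
  refine (iInf₂_le π ⟨h1, h2⟩).trans ?_
  rw [ENNReal.ofReal_mul (by norm_num), ← lintegral_chord, ← lintegral_const_mul' _ _ (by simp)]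
  refine lintegral_mono fun p => ?_
  rw [← ENNReal.ofReal_mul (by norm_num)]
  exact ENNReal.ofReal_le_ofReal (dist_le_chord hε hε' p.1 p.2)

theorem integral_chord_le_lintegral_dist (hε : 0 < ε) (hε' : ε < Real.pi / 2)
    (π : Measure (Disk ε × Disk ε)) [IsFiniteMeasure π] :
    ENNReal.ofReal (∫ p, chord p.1.1 p.2.1 ∂π) ≤
      2 * ∫⁻ p, ENNReal.ofReal (dist p.1.1 p.2.1) ∂π := by
  rw [← lintegral_chord, ← lintegral_const_mul' _ _ (by simp)]
  refine lintegral_mono fun p => ?_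
  rw [← ENNReal.ofReal_ofNat, ← ENNReal.ofReal_mul (by norm_num)]
  exact ENNReal.ofReal_le_ofReal (chord_le_dist hε hε' p.1 p.2)

/-- Over a short time, which depends on the interaction potential only, the Wasserstein distance
of two weak solutions is at most a multiple of the initial one. -/
theorem exists_W1_stability (hε : 0 < ε) (hε' : ε < Real.pi / 2) {K : SO3 → SO3 → ℝ}
    (hK : IsInteractionPotential K) :
    ∃ δ : ℝ, 0 < δ ∧ ∀ (T : EReal) (τ : ℝ), 0 ≤ τ → τ ≤ δ → (τ : EReal) < T →
      ∀ ρ σ : ℝ → ProbabilityMeasure (Disk ε), IsWeakSolution K T ρ → IsWeakSolution K T σ →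
        ∀ t ∈ Icc 0 τ, W1 (ρ t) (σ t) ≤ 36 * W1 (ρ 0) (σ 0) := by
  obtain ⟨B, hB, hvel⟩ := exists_velocity_lipschitz hε hε' hK
  refine ⟨Real.log (3 / 2) / B, div_pos (Real.log_pos (by norm_num)) hB, ?_⟩
  rintro T τ hτ0 hτ hτT ρ σ ⟨Φ, hΦ, -, hρ⟩ ⟨Ψ, hΨ, -, hσ⟩
  have hsub : Icc 0 τ ⊆ timeInterval T := fun t ht =>
    ⟨ht.1, (EReal.coe_le_coe_iff.2 ht.2).trans_lt hτT⟩
  have hexp : Real.exp (B * τ) ≤ 3 / 2 := by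
    rw [← Real.le_log_iff_exp_le (by norm_num), mul_comm, ← le_div_iff₀ hB]
    exact hτ
  have main : ∀ π : Measure (Disk ε × Disk ε), π.map Prod.fst = (ρ 0 : Measure (Disk ε)) →
      π.map Prod.snd = (σ 0 : Measure (Disk ε)) → ∀ t ∈ Icc 0 τ,
        W1 (ρ t) (σ t) ≤ 36 * ∫⁻ p, ENNReal.ofReal (dist p.1.1 p.2.1) ∂π := by
    intro π h1 h2
    have hprob := isProbabilityMeasure_of_map_fst h1
    set U : ℝ → ℝ := fun t =>
      ∫ p, chord p.1.1 p.2.1 ∂(π.map fun p => (Φ t p.1, Ψ t p.2))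
    have hmarg := fun t (ht : t ∈ Icc 0 τ) =>
      map_prodMap_marginals (hρ t (hsub ht)) (hσ t (hsub ht)) h1 h2
    have hUeq : ∀ t ∈ Icc 0 τ, U t = ∫ p, chord (Φ t p.1).1 (Ψ t p.2).1 ∂π := fun t ht =>
      integral_map (hmarg t ht).1 continuous_disk_chord.aestronglyMeasurable
    have hint : ∀ t ∈ Icc 0 τ, Integrable (fun p => chord (Φ t p.1).1 (Ψ t p.2).1) π :=
      fun t ht => Integrable.of_bound (continuous_disk_chord.measurable.comp_aemeasurable
        (hmarg t ht).1).aestronglyMeasurable 2 (Eventually.of_forall fun p => by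
          rw [Real.norm_eq_abs, abs_of_nonneg (chord_nonneg _ _)]
          exact chord_le_two _ _)
    have hU0 : ∀ t, 0 ≤ U t := fun t => integral_nonneg fun p => chord_nonneg _ _
    have hU2 : ∀ t ∈ Icc 0 τ, U t ≤ 2 := fun t ht => by
      rw [hUeq t ht]
      refine (integral_mono (hint t ht) (integrable_const 2) fun p => chord_le_two _ _).trans ?_
      simp
    have hbdd : BddAbove (U '' Icc 0 τ) := ⟨2, by rintro _ ⟨t, ht, rfl⟩; exact hU2 t ht⟩
    have hne : (U '' Icc 0 τ).Nonempty := (nonempty_Icc.2 hτ0).image U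
    -- Freezing the cost at its supremum makes the forcing constant in time, so no regularity of `U`
    -- in time is needed.
    set M := sSup (U '' Icc 0 τ)
    have hUM : ∀ t ∈ Icc 0 τ, U t ≤ M := fun t ht => le_csSup hbdd ⟨t, ht, rfl⟩
    have hM : 0 ≤ M := (hU0 0).trans (hUM 0 ⟨le_rfl, hτ0⟩)
    -- The flow equations hold only on the supports, which contain both coordinates of `π`-almost
    -- every pair.
    have hae : ∀ᵐ p ∂π, p.1 ∈ (ρ 0 : Measure (Disk ε)).support ∧
        p.2 ∈ (σ 0 : Measure (Disk ε)).support := by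
      have a1 : ∀ᵐ x ∂(π.map Prod.fst), x ∈ (ρ 0 : Measure (Disk ε)).support := by
        rw [h1]; exact Measure.support_mem_ae
      have a2 : ∀ᵐ x ∂(π.map Prod.snd), x ∈ (σ 0 : Measure (Disk ε)).support := by
        rw [h2]; exact Measure.support_mem_ae
      exact (ae_of_ae_map measurable_fst.aemeasurable a1).and
        (ae_of_ae_map measurable_snd.aemeasurable a2)
    have hstep : ∀ t ∈ Icc 0 τ, U t ≤ 3 / 2 * (∫ p, chord p.1.1 p.2.1 ∂π) + M / 2 := by
      intro t ht
      have hpt : ∀ᵐ p ∂π, chord (Φ t p.1).1 (Ψ t p.2).1 ≤ 3 / 2 * chord p.1.1 p.2.1 + M / 2 := by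
        filter_upwards [hae] with p hp
        obtain ⟨hx0, hx⟩ := hΦ p.1 hp.1
        obtain ⟨hy0, hy⟩ := hΨ p.2 hp.2
        have := chord_le_of_velocity_le hsub hB hexp hM hx hy (fun s hs i j => by
          refine (hvel (ρ s) (σ s) _ (hmarg s hs).2.1 (hmarg s hs).2.2 (Φ s p.1) (Ψ s p.2)
            i j).trans (mul_le_mul_of_nonneg_left ?_ hB.le)
          have := hUM s hs
          exact add_le_add le_rfl this) t ht
        rwa [hx0, hy0] at this
      rw [hUeq t ht]
      have i0 := (integrable_chord π).const_mul (3 / 2)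
      refine (integral_mono_ae (hint t ht) (i0.add (integrable_const (M / 2))) hpt).trans ?_
      rw [integral_add' i0 (integrable_const _), integral_const_mul, integral_const]
      simp
    -- `M` is a real supremum thanks to `hbdd`, so `M / 2` can be absorbed.
    have hMle : M ≤ 3 * ∫ p, chord p.1.1 p.2.1 ∂π := by
      have : M ≤ 3 / 2 * (∫ p, chord p.1.1 p.2.1 ∂π) + M / 2 := csSup_le hne (by
        rintro _ ⟨t, ht, rfl⟩; exact hstep t ht)
      linarith
    intro t ht
    -- The constant is `36 = 6 · 3 · 2`: chordal to geodesic distance, the bound on `M`, and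
    -- geodesic to chordal distance.
    calc W1 (ρ t) (σ t) ≤ ENNReal.ofReal (6 * U t) :=
          W1_le_of_plan hε hε' (hmarg t ht).2.1 (hmarg t ht).2.2
      _ ≤ ENNReal.ofReal (18 * ∫ p, chord p.1.1 p.2.1 ∂π) :=
        ENNReal.ofReal_le_ofReal (by linarith [hUM t ht])
      _ = 18 * ENNReal.ofReal (∫ p, chord p.1.1 p.2.1 ∂π) := by
        rw [ENNReal.ofReal_mul (by norm_num), ENNReal.ofReal_ofNat]
      _ ≤ 18 * (2 * ∫⁻ p, ENNReal.ofReal (dist p.1.1 p.2.1) ∂π) := by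
        gcongr; exact integral_chord_le_lintegral_dist hε hε' π
      _ = 36 * ∫⁻ p, ENNReal.ofReal (dist p.1.1 p.2.1) ∂π := by
        rw [← mul_assoc]; norm_num
  intro t ht
  -- `main` holds for every plan, so the infimum can be taken without an optimal one.
  conv_rhs => rw [W1]
  rw [ENNReal.mul_iInf_of_ne (by norm_num) (by norm_num)]
  refine le_iInf fun π => ?_
  rw [ENNReal.mul_iInf_of_ne (by norm_num) (by norm_num)]
  exact le_iInf fun hπ => main π hπ.1 hπ.2 t ht

end

end RotationAggregation

theorem mainTheorem7 (ε : ℝ) (hε : 0 < ε) (hε' : ε < Real.pi / 2)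
    (K : RotationAggregation.SO3 → RotationAggregation.SO3 → ℝ)
    (hK : RotationAggregation.IsInteractionPotential K)
    (T : EReal) (hT : 0 < T)
    (ρ : ℝ → ProbabilityMeasure (RotationAggregation.Disk ε))
    (ρN : ℕ → ℝ → ProbabilityMeasure (RotationAggregation.Disk ε))
    (hρ : RotationAggregation.IsWeakSolution K T ρ)
    (hρN : ∀ N : ℕ, 1 ≤ N → RotationAggregation.IsWeakSolution K T (ρN N))
    (hemp : ∀ N : ℕ, 1 ≤ N → RotationAggregation.IsEmpirical N (ρN N 0))
    (hconv : Tendsto (fun N => RotationAggregation.W1 (ρN N 0) (ρ 0)) atTop (𝓝 0)) :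
    ∃ Tstar : ℝ, 0 < Tstar ∧ (Tstar : EReal) < T ∧
      Tendsto (fun N => ⨆ t ∈ Ico (0 : ℝ) Tstar, RotationAggregation.W1 (ρN N t) (ρ t))
        atTop (𝓝 0) := by
  obtain ⟨δ, hδ, hstab⟩ := RotationAggregation.exists_W1_stability hε hε' hK
  -- A real time below `T` is needed because `T` may be infinite.
  obtain ⟨r, hr0, hrT⟩ := EReal.lt_iff_exists_real_btwn.1 hT
  have hr : 0 < r := by exact_mod_cast hr0
  have hτ : 0 < min δ r := lt_min hδ hr
  have hτT : ((min δ r : ℝ) : EReal) < T :=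
    (EReal.coe_le_coe_iff.2 (min_le_right δ r)).trans_lt hrT
  refine ⟨min δ r, hτ, hτT, ?_⟩
  have hlim : Tendsto (fun N => 36 * RotationAggregation.W1 (ρN N 0) (ρ 0)) atTop (𝓝 0) := by
    simpa using ENNReal.Tendsto.const_mul hconv (Or.inr (by norm_num : (36 : ℝ≥0∞) ≠ ⊤))
  refine tendsto_of_tendsto_of_tendsto_of_le_of_le' tendsto_const_nhds hlim
    (Eventually.of_forall fun _ => zero_le) ?_
  filter_upwards [eventually_ge_atTop 1] with N hN
  exact iSup₂_le fun t ht => hstab T _ hτ.le (min_le_left δ r) hτT _ _ (hρN N hN) hρ t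
    (Ico_subset_Icc_self ht)
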